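/- Let $L$ be a group, regarded as a first-order structure in some language in which the group law of $L$ is $\emptyset$-definable (additional structure is allowed). "Definable" means definable with parameters in this structure. For subgroups $H,K\le L$ let $$\widetilde C_K(H)=\{g\in K : [H:C_H(g)]<\infty\},\qquad \widetilde Z(L)=\widetilde C_L(L).$$ (1) Suppose that $L$ is $\aleph_0$-saturated, i.e. every partial $1$-type over a finite set of parameters that is finitely satisfiable in $L$ is realised in $L$. Let $H$ and $K$ be definable subgroups of $L$ such that $K$ normalizes $H$. If $K\le\widetilde C_L(H)$ and $H\le\widetilde C_L(K)$, then the commutator subgroup $[K,H]$ is finite. (2) Suppose that $L$ is an $\widetilde{\mathfrak M}_c$-group, i.e. for any two definable subgroups $H,N$ of $L$ with $N$ normalized by $H$ there are natural numbers $n,d$ such that every chain of centralizers $$C_{H/N}(g_0N)\ge C_{H/N}(g_0N,g_1N)\ge\dots\ge C_{H/N}(g_0N,\dots,g_{m}N)\ge\cdots\qquad(g_i\in H)$$ in $H/N:=H/(H\cap N)$, in which every term after the first has (possibly infinite) index at least $d$ in its predecessor, has length at most $n$. Then the commutator subgroup $[\widetilde Z(L),\widetilde C_L(\widetilde Z(L))]$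 is finite. (No saturation is assumed in this part.) -/

import Mathlib

namespace AlmostCentralizer

open FirstOrder Cardinal

/-- A first-order structure on the group `G` (possibly with extra structure, in an arbitrary
language) is an expansion of the group `G` if the group law is definable without parameters. -/
def ExpandsGroup (Lang : Language) (G : Type*) [Group G] [Lang.Structure G] : Prop :=
  (∅ : Set G).Definable Lang {v : Fin 3 → G | v 0 * v 1 = v 2}

/-- A subgroup is definable if it is first-order definable with parameters. -/
def IsDefinable (Lang : Language) {G : Type*} [Group G] [Lang.Structure G]
    (H : Subgroup G) : Prop :=
  (Set.univ : Set G).Definable₁ Lang (H : Set G)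

/-- `M` is `κ`-saturated: for every parameter set `A` of cardinality less than `κ`, every
partial `1`-type over `A` which is finitely satisfiable in `M` is realised in `M`. A partial type
over `A` is presented as a family of `A`-definable subsets of `M`. -/
def IsSaturated (Lang : Language) {M : Type*} [Lang.Structure M] (κ : Cardinal) : Prop :=
  ∀ A : Set M, #A < κ → ∀ p : Set (Set M), (∀ S ∈ p, A.Definable₁ Lang S) →
    (∀ q ⊆ p, q.Finite → (⋂₀ q).Nonempty) → (⋂₀ p).Nonempty

/-- The almost centralizer of `H` in `K`: the elements `g` of `K` such that
`C_H(g) = C(g) ∩ H` has finite index in `H`. -/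
def almostCentralizer {G : Type*} [Group G] (K H : Subgroup G) : Subgroup G where
  carrier := {g | g ∈ K ∧ (Subgroup.centralizer {g}).IsFiniteRelIndex H}
  one_mem' := by
    refine ⟨K.one_mem, ⟨?_⟩⟩
    have h : Subgroup.centralizer ({1} : Set G) = ⊤ := by
      ext x; simp [Subgroup.mem_centralizer_iff]
    simp [h]
  mul_mem' := by
    rintro a b ⟨ha, ⟨ha'⟩⟩ ⟨hb, ⟨hb'⟩⟩
    refine ⟨K.mul_mem ha hb, ⟨?_⟩⟩
    have h : Subgroup.centralizer {a} ⊓ Subgroup.centralizer {b} ≤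
        Subgroup.centralizer ({a * b} : Set G) := by
      intro x hx
      obtain ⟨hxa, hxb⟩ := Subgroup.mem_inf.1 hx
      simp only [Subgroup.mem_centralizer_iff, Set.mem_singleton_iff, forall_eq] at hxa hxb ⊢
      rw [mul_assoc, hxb, ← mul_assoc, hxa, mul_assoc]
    exact fun h0 => Subgroup.relIndex_inf_ne_zero ha' hb'
      (Subgroup.relIndex_eq_zero_of_le_left h h0)
  inv_mem' := by
    rintro a ⟨ha, ⟨ha'⟩⟩
    refine ⟨K.inv_mem ha, ⟨?_⟩⟩
    have h : Subgroup.centralizer ({a⁻¹} : Set G) = Subgroup.centralizer {a} := by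
      ext x
      simp only [Subgroup.mem_centralizer_iff, Set.mem_singleton_iff, forall_eq]
      exact ⟨fun hx => (Commute.inv_left_iff (a := a) (b := x)).1 hx,
        fun hx => (Commute.inv_left_iff (a := a) (b := x)).2 hx⟩
    rwa [h]

/-- The almost center of a group. -/
def almostCenter (G : Type*) [Group G] : Subgroup G := almostCentralizer ⊤ ⊤

/-- The index of `A` in `B` is at least `d` (an infinite index is at least every `d`; Mathlib's
`relIndex` is `0` when the index is infinite). -/
def IndexAtLeast {G : Type*} [Group G] (d : ℕ) (A B : Subgroup G) : Prop :=
  A.relIndex B = 0 ∨ d ≤ A.relIndex B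

/-- In `Q` there are no chains of more than `n` centralizers
`C(g 0) ≥ C(g 0, g 1) ≥ ... ≥ C(g 0, ..., g (m - 1))` in which each term after the first
has index at least `d` in its predecessor. -/
def CentralizerChainsBounded (Q : Type*) [Group Q] (n d : ℕ) : Prop :=
  ∀ (m : ℕ) (g : ℕ → Q),
    (∀ i, i + 1 < m → IndexAtLeast d (Subgroup.centralizer (g '' Set.Iic (i + 1)))
      (Subgroup.centralizer (g '' Set.Iic i))) → m ≤ n

/-- The chain condition on centralizers up to finite index, for all definable quotients
`H / N = H / (H ∩ N)`, where `H` and `N` are definable subgroups and `H` normalizes `N`. -/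
def IsMcTilde (Lang : Language) (G : Type*) [Group G] [Lang.Structure G] : Prop :=
  ∀ H N : Subgroup G, IsDefinable Lang H → IsDefinable Lang N →
    ∀ hHN : H ≤ Subgroup.normalizer N,
      haveI : (N.subgroupOf H).Normal := Subgroup.normal_subgroupOf_of_le_normalizer hHN
      ∃ n d : ℕ, CentralizerChainsBounded (H ⧸ N.subgroupOf H) n d

end AlmostCentralizer

/-!
Both parts reduce to one group-theoretic statement: if `K` normalizes `H`, the two almost
centralize each other, and the indices `[H : C_H(k)]` for `k ∈ K` are bounded, then `[K, H]` is
finite.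

Let `k ∈ K` have the largest number of `H`-conjugates, attained on a finite set `R ⊆ H` of
conjugators. For `c ∈ C_K(R)` the products of these conjugates with `c` are conjugates of `k * c`,
hence all of them by maximality, and `[c, h]` is a quotient of two conjugates of `k`. As `C_K(R)`
has finite index in `K`, there are only finitely many commutators `[k, h]`.

So `D = [K, H]` is finitely generated with centre of finite index `e`, and `a ↦ a ^ e` is an
endomorphism of `D`. If `k ^ n` commutes with `h` and `k` commutes with `[k, h] ^ M` for a multiple
`M` of `e`, then `1 = [k ^ n, h] ^ M = [k, h] ^ (M * n)`. Hence `D` is generated by finitely many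
elements of finite order, and is finite.

The bound on the indices comes from compactness in the saturated case. Under the chain condition, a
chain of centralizers of elements of `K` that cannot be prolonged gives a finite `F ⊆ K` with
`[C(F) : C(F, k)] < d` for all `k ∈ K`.
-/

namespace AlmostCentralizer

open scoped Pointwise commutatorElement

variable {G : Type*} [Group G] {H K : Subgroup G}

section Conjugates

/-- The `H`-conjugates of `x`, where `x` need not belong to `H`. Their number is `[H : C_H(x)]`. -/
def conjugates (H : Subgroup G) (x : G) : Set G := (fun h => h * x * h⁻¹) '' H

theorem ncard_conjugates (H : Subgroup G) (x : G) :
    (conjugates H x).ncard = (Subgroup.centralizer {x}).relIndex H := by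
  let conjAction : MulAction H G := MulAction.compHom G (MulAut.conj.comp H.subtype)
  have hsmul (h : H) (y : G) : h • y = h * y * (h : G)⁻¹ := rfl
  have hstab : MulAction.stabilizer H x = (Subgroup.centralizer {x}).subgroupOf H := by
    ext h
    rw [MulAction.mem_stabilizer_iff, hsmul, mul_inv_eq_iff_eq_mul, Subgroup.mem_subgroupOf,
      Subgroup.mem_centralizer_singleton_iff]
  have horbit : MulAction.orbit H x = conjugates H x := by
    ext y
    simp [MulAction.mem_orbit_iff, hsmul, conjugates]
  rw [Subgroup.relIndex, ← hstab, MulAction.index_stabilizer, horbit]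

theorem mem_almostCentralizer_top_iff_relIndex_ne_zero {x : G} :
    x ∈ almostCentralizer ⊤ H ↔ (Subgroup.centralizer {x}).relIndex H ≠ 0 :=
  ⟨fun hx => hx.2.relIndex_ne_zero, fun hx => ⟨Subgroup.mem_top x, ⟨hx⟩⟩⟩

theorem mem_almostCentralizer_top_iff_finite_conjugates {x : G} :
    x ∈ almostCentralizer ⊤ H ↔ (conjugates H x).Finite := by
  rw [mem_almostCentralizer_top_iff_relIndex_ne_zero, ← ncard_conjugates]
  exact ⟨Set.finite_of_ncard_ne_zero, fun hfin =>
    Set.ncard_ne_zero_of_mem (a := 1 * x * 1⁻¹) ⟨1, H.one_mem, rfl⟩ hfin⟩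

theorem almostCentralizer_anti_right (L : Subgroup G) (hHK : H ≤ K) :
    almostCentralizer L K ≤ almostCentralizer L H := fun _ ⟨hxL, _⟩ =>
  ⟨hxL, Subgroup.isFiniteRelIndex_of_le_right _ hHK⟩

theorem relIndex_centralizer_ne_zero_of_finite {S : Set G} (hS : S.Finite)
    (hSH : S ⊆ almostCentralizer ⊤ H) : (Subgroup.centralizer S).relIndex H ≠ 0 := by
  have := hS.to_subtype
  rw [Subgroup.centralizer_eq_iInf, iInf_subtype']
  exact Subgroup.relIndex_iInf_ne_zero fun s =>
    mem_almostCentralizer_top_iff_relIndex_ne_zero.1 (hSH s.2)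

end Conjugates

section FinitelyManyCommutators

/-- The set of commutators `⁅k, h⁆` generating `⁅K, H⁆`. -/
def commutators (K H : Subgroup G) : Set G := {g | ∃ k ∈ K, ∃ h ∈ H, ⁅k, h⁆ = g}

theorem conjugates_mul_eq_image {R : Set G} {k c : G} (hRH : R ⊆ H)
    (hR : (fun r => r * k * r⁻¹) '' R = conjugates H k) (hc : c ∈ Subgroup.centralizer R)
    (hfin : (conjugates H (k * c)).Finite)
    (hle : (conjugates H (k * c)).ncard ≤ (conjugates H k).ncard) :
    conjugates H (k * c) = (· * c) '' conjugates H k := by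
  refine (Set.eq_of_subset_of_ncard_le ?_ ?_ hfin).symm
  · rw [← hR]
    rintro _ ⟨_, ⟨r, hr, rfl⟩, rfl⟩
    have hrc : Commute r⁻¹ c := Commute.inv_left (hc r hr)
    refine ⟨r, hRH hr, ?_⟩
    simp only [mul_assoc, hrc.eq]
  · rwa [Set.ncard_image_of_injective _ (mul_left_injective c)]

theorem commutatorElement_mem_of_conjugates_mul_eq_image {k c h : G}
    (heq : conjugates H (k * c) = (· * c) '' conjugates H k) (hh : h ∈ H) :
    ⁅c, h⁆ ∈ (conjugates H k)⁻¹ * conjugates H k := by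
  have hkc : h * (k * c) * h⁻¹ ∈ conjugates H (k * c) := ⟨h, hh, rfl⟩
  rw [heq] at hkc
  obtain ⟨y, hy, hyc : y * c = h * (k * c) * h⁻¹⟩ := hkc
  refine ⟨y⁻¹, Set.inv_mem_inv.2 hy, h * k * h⁻¹, ⟨h, hh, rfl⟩, ?_⟩
  change y⁻¹ * (h * k * h⁻¹) = ⁅c, h⁆
  rw [eq_mul_inv_of_mul_eq hyc, commutatorElement_def]
  group

theorem finite_commutators_of_relIndex_ne_zero {C : Subgroup G} (hC : C.relIndex K ≠ 0)
    (hKH : K ≤ almostCentralizer ⊤ H) (hfin : (commutators (C ⊓ K) H).Finite) :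
    (commutators K H).Finite := by
  have : Finite (K ⧸ C.subgroupOf K) := Subgroup.index_ne_zero_iff_finite.1 hC
  have finite_coset (q : K ⧸ C.subgroupOf K) :
      {g | ∃ k : K, (k : K ⧸ C.subgroupOf K) = q ∧ ∃ h ∈ H, ⁅(k : G), h⁆ = g}.Finite := by
    induction q using QuotientGroup.induction_on with | H t =>
    have hconj := mem_almostCentralizer_top_iff_finite_conjugates.1 (hKH t.2)
    refine (((hfin.image fun g => t * g * (t : G)⁻¹).mul
      (Set.finite_singleton (t : G))).mul hconj.inv).subset ?_
    rintro _ ⟨k, hkt, h, hh, rfl⟩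
    have hc : (t : G)⁻¹ * k ∈ C ⊓ K :=
      ⟨by simpa [Subgroup.mem_subgroupOf] using QuotientGroup.eq.1 hkt.symm,
        K.mul_mem (K.inv_mem t.2) k.2⟩
    refine ⟨_, ⟨_, ⟨_, ⟨_, hc, h, hh, rfl⟩, rfl⟩, _, rfl, rfl⟩, (h * t * h⁻¹)⁻¹,
      Set.inv_mem_inv.2 ⟨h, hh, rfl⟩, ?_⟩
    simp only [commutatorElement_def]
    group
  refine (Set.finite_iUnion finite_coset).subset ?_
  rintro _ ⟨k, hk, h, hh, rfl⟩
  exact Set.mem_iUnion.2 ⟨_, ⟨k, hk⟩, rfl, h, hh, rfl⟩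

theorem finite_commutators_of_relIndex_le {n : ℕ} (hKH : K ≤ almostCentralizer ⊤ H)
    (hHK : H ≤ almostCentralizer ⊤ K)
    (hn : ∀ k ∈ K, (Subgroup.centralizer {k}).relIndex H ≤ n) : (commutators K H).Finite := by
  have hfin {k : G} (hk : k ∈ K) : (conjugates H k).Finite :=
    mem_almostCentralizer_top_iff_finite_conjugates.1 (hKH hk)
  simp only [← ncard_conjugates] at hn
  obtain ⟨k, hk, hmax⟩ := Set.Finite.exists_maximalFor' (fun k => (conjugates H k).ncard) K
    ((Set.finite_Iic n).subset (Set.image_subset_iff.2 hn)) ⟨1, K.one_mem⟩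
  obtain ⟨R, hRH, hbij⟩ := (Set.surjOn_image (fun h => h * k * h⁻¹) (H : Set G)).exists_bijOn_subset
  have hRfin : R.Finite := hbij.finite_iff_finite.2 (hfin hk)
  refine finite_commutators_of_relIndex_ne_zero (C := Subgroup.centralizer R)
    (relIndex_centralizer_ne_zero_of_finite hRfin (hRH.trans hHK)) hKH
    (((hfin hk).inv.mul (hfin hk)).subset ?_)
  rintro _ ⟨c, ⟨hcR, hcK⟩, h, hh, rfl⟩
  have hkc : k * c ∈ K := K.mul_mem hk hcK
  have hle : (conjugates H (k * c)).ncard ≤ (conjugates H k).ncard :=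
    (le_total _ _).elim id (hmax hkc)
  exact commutatorElement_mem_of_conjugates_mul_eq_image
    (conjugates_mul_eq_image hRH hbij.image_eq hcR (hfin hkc) hle) hh

end FinitelyManyCommutators

section FiniteCommutatorSubgroup

theorem mul_pow_of_index_center_dvd [(Subgroup.center G).FiniteIndex] {M : ℕ}
    (hM : (Subgroup.center G).index ∣ M) (a b : G) : (a * b) ^ M = a ^ M * b ^ M := by
  obtain ⟨j, rfl⟩ := hM
  have hmul : (a * b) ^ (Subgroup.center G).index =
      a ^ (Subgroup.center G).index * b ^ (Subgroup.center G).index := by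
    simpa only [MonoidHom.transferCenterPow_apply, Subgroup.coe_mul] using
      congrArg Subtype.val (map_mul (MonoidHom.transferCenterPow G) a b)
  have hcomm : Commute (a ^ (Subgroup.center G).index) (b ^ (Subgroup.center G).index) :=
    (Subgroup.mem_center_iff.1 ((Subgroup.center G).pow_index_mem b) _)
  rw [pow_mul, pow_mul, pow_mul, hmul, hcomm.mul_pow]

theorem finite_of_closure_eq_top_of_isOfFinOrder [hZ : (Subgroup.center G).FiniteIndex] {S : Set G}
    (hS : S.Finite) (hgen : Subgroup.closure S = ⊤) (hord : ∀ s ∈ S, IsOfFinOrder s) :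
    Finite G := by
  let _ : CommGroup (Subgroup.center G) := { mul_comm := mul_comm' }
  let pow : G →* Subgroup.center G := MonoidHom.transferCenterPow G
  have hpow (a : G) : (pow a : G) = a ^ (Subgroup.center G).index :=
    MonoidHom.transferCenterPow_apply a
  have top_le : ⊤ ≤ (CommGroup.torsion (Subgroup.center G)).comap pow := by
    rw [← hgen, Subgroup.closure_le]
    exact fun s hs => pow.isOfFinOrder (hord s hs)
  have torsion : IsMulTorsion (Subgroup.center G) := fun z => by
    have hz : IsOfFinOrder ((pow z : Subgroup.center G) : G) :=
      Submonoid.isOfFinOrder_coe.2 (top_le (Subgroup.mem_top (z : G)))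
    rw [hpow, isOfFinOrder_pow] at hz
    exact Submonoid.isOfFinOrder_coe.1 (hz.resolve_right hZ.index_ne_zero)
  have : Group.FG G := Group.fg_iff.2 ⟨S, hgen, hS⟩
  have : Finite (Subgroup.center G) := CommGroup.finite_of_fg_isMulTorsion _ torsion
  exact Nat.finite_of_card_ne_zero <| (Subgroup.center G).card_mul_index ▸
    mul_ne_zero Nat.card_pos.ne' hZ.index_ne_zero

theorem commutatorElement_pow_left_pow {D : Subgroup G} {M : ℕ}
    (hM : ∀ a ∈ D, ∀ b ∈ D, (a * b) ^ M = a ^ M * b ^ M) {k h : G} (hD : ∀ m : ℕ, ⁅k ^ m, h⁆ ∈ D)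
    (hk : Commute k (⁅k, h⁆ ^ M)) (m : ℕ) : ⁅k ^ m, h⁆ ^ M = (⁅k, h⁆ ^ M) ^ m := by
  induction m with
  | zero => simp
  | succ m ih =>
    have hkD : ⁅k, h⁆ ∈ D := by simpa only [pow_one] using hD 1
    have hsucc : ⁅k ^ (m + 1), h⁆ = k * ⁅k ^ m, h⁆ * k⁻¹ * ⁅k, h⁆ := by
      simp only [commutatorElement_def]
      group
    have hconj : k * ⁅k ^ m, h⁆ * k⁻¹ ∈ D := by
      rw [eq_mul_inv_of_mul_eq hsucc.symm]
      exact D.mul_mem (hD _) (D.inv_mem hkD)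
    rw [hsucc, hM _ hconj _ hkD, conj_pow, ih, (hk.pow_right m).eq, mul_inv_cancel_right, pow_succ]

theorem isOfFinOrder_of_mem_commutators [(Subgroup.center (⁅K, H⁆ : Subgroup G)).FiniteIndex]
    (hDH : ⁅K, H⁆ ≤ H) (hKH : K ≤ almostCentralizer ⊤ H) (hHK : H ≤ almostCentralizer ⊤ K)
    {x : G} (hx : x ∈ commutators K H) : IsOfFinOrder x := by
  obtain ⟨k, hk, h, hh, rfl⟩ := hx
  have hD (m : ℕ) : ⁅k ^ m, h⁆ ∈ ⁅K, H⁆ := Subgroup.commutator_mem_commutator (K.pow_mem hk m) hh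
  have hkh : ⁅k, h⁆ ∈ H := hDH (Subgroup.commutator_mem_commutator hk hh)
  let e := (Subgroup.center (⁅K, H⁆ : Subgroup G)).index
  have he : 0 < e := Nat.pos_of_ne_zero Subgroup.FiniteIndex.index_ne_zero
  obtain ⟨n, hn, -, hnC⟩ := Subgroup.exists_pow_mem_of_relIndex_ne_zero
    (mem_almostCentralizer_top_iff_relIndex_ne_zero.1 (hHK hh)) hk
  obtain ⟨j, hj, -, hjC⟩ := Subgroup.exists_pow_mem_of_relIndex_ne_zero
    (mem_almostCentralizer_top_iff_relIndex_ne_zero.1 (hKH hk)) (H.pow_mem hkh e)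
  have hkn : Commute (k ^ n) h := Subgroup.mem_centralizer_singleton_iff.1 hnC.1
  have hkM : Commute k (⁅k, h⁆ ^ (e * j)) := by
    rw [pow_mul]
    exact (Subgroup.mem_centralizer_singleton_iff.1 hjC.1).symm
  have hpow : ∀ a ∈ ⁅K, H⁆, ∀ b ∈ ⁅K, H⁆, (a * b) ^ (e * j) = a ^ (e * j) * b ^ (e * j) :=
    fun a ha b hb => congrArg Subtype.val
      (mul_pow_of_index_center_dvd (Dvd.intro j rfl) (⟨a, ha⟩ : (⁅K, H⁆ : Subgroup G)) ⟨b, hb⟩)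
  refine isOfFinOrder_iff_pow_eq_one.2 ⟨e * j * n, Nat.mul_pos (Nat.mul_pos he hj) hn, ?_⟩
  rw [pow_mul, ← commutatorElement_pow_left_pow hpow hD hkM, hkn.commutator_eq, one_pow]

theorem commutators_subset_almostCentralizer (hS : (commutators K H).Finite) :
    commutators K H ⊆ almostCentralizer ⊤ H := by
  rintro _ ⟨k, hk, h, hh, rfl⟩
  refine mem_almostCentralizer_top_iff_finite_conjugates.2 ((hS.inv.mul hS).subset ?_)
  rintro _ ⟨g, hg, rfl⟩
  refine ⟨⁅k, g⁆⁻¹, Set.inv_mem_inv.2 ⟨k, hk, g, hg, rfl⟩, ⁅k, g * h⁆,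
    ⟨k, hk, _, H.mul_mem hg hh, rfl⟩, ?_⟩
  simp only [commutatorElement_def]
  group

theorem finiteIndex_center_of_relIndex_centralizer_ne_zero {D : Subgroup G}
    (hD : (Subgroup.centralizer (D : Set G)).relIndex D ≠ 0) :
    (Subgroup.center D).FiniteIndex := by
  have hcenter : (Subgroup.centralizer (D : Set G)).subgroupOf D = Subgroup.center D := by
    ext x
    simp [Subgroup.mem_subgroupOf, Subgroup.mem_centralizer_iff, Subgroup.mem_center_iff,
      Subtype.ext_iff]
  exact ⟨hcenter ▸ hD⟩

theorem finite_commutator_of_finite_commutators (hKN : K ≤ Subgroup.normalizer H)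
    (hKH : K ≤ almostCentralizer ⊤ H) (hHK : H ≤ almostCentralizer ⊤ K)
    (hS : (commutators K H).Finite) : Finite (⁅K, H⁆ : Subgroup G) := by
  have hDH : ⁅K, H⁆ ≤ H := Subgroup.le_normalizer_iff_commutator_le_right.1 hKN
  have hcentralizer :
      (Subgroup.centralizer ((⁅K, H⁆ : Subgroup G) : Set G)).relIndex ⁅K, H⁆ ≠ 0 := by
    rw [Subgroup.commutator_def, Subgroup.centralizer_closure, ← Subgroup.commutator_def]
    exact relIndex_centralizer_ne_zero_of_finite hS
      ((commutators_subset_almostCentralizer hS).trans (almostCentralizer_anti_right ⊤ hDH))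
  have hcenter := finiteIndex_center_of_relIndex_centralizer_ne_zero hcentralizer
  have hgen : Subgroup.closure (Subtype.val ⁻¹' commutators K H : Set (⁅K, H⁆ : Subgroup G)) = ⊤ :=
    Subgroup.closure_closure_coe_preimage
  exact finite_of_closure_eq_top_of_isOfFinOrder (hS.preimage Subtype.val_injective.injOn) hgen
    fun s hs => Submonoid.isOfFinOrder_coe.1 (isOfFinOrder_of_mem_commutators hDH hKH hHK hs)

theorem finite_commutator_of_relIndex_le {n : ℕ} (hKN : K ≤ Subgroup.normalizer H)
    (hKH : K ≤ almostCentralizer ⊤ H) (hHK : H ≤ almostCentralizer ⊤ K)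
    (hn : ∀ k ∈ K, (Subgroup.centralizer {k}).relIndex H ≤ n) :
    Finite (⁅K, H⁆ : Subgroup G) :=
  finite_commutator_of_finite_commutators hKN hKH hHK
    (finite_commutators_of_relIndex_le hKH hHK hn)

end FiniteCommutatorSubgroup

section Saturation

open FirstOrder Cardinal

variable {Lang : Language} {M : Type*} [Lang.Structure M] {A : Set M}

theorem definable_apply_mem {α : Type*} {S : Set M} (hS : A.Definable₁ Lang S) (i : α) :
    A.Definable Lang {v : α → M | v i ∈ S} :=
  Set.Definable.preimage_comp (fun _ : Fin 1 => i) hS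

theorem natCast_le_encard_iff {α : Type*} {s : Set α} {n : ℕ} :
    (n : ℕ∞) ≤ s.encard ↔ ∃ f : Fin n → α, Function.Injective f ∧ ∀ i, f i ∈ s := by
  constructor
  · intro hn
    obtain ⟨t, hts, ht⟩ := Set.exists_subset_encard_eq hn
    have htfin : t.Finite := Set.finite_of_encard_eq_coe ht
    have := htfin.to_subtype
    have e : t ≃ Fin n := Finite.equivFinOfCardEq (by simp [Set.ncard, ht])
    exact ⟨fun i => e.symm i, Subtype.val_injective.comp e.symm.injective,
      fun i => hts (e.symm i).2⟩
  · rintro ⟨f, hf, hfs⟩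
    calc (n : ℕ∞) = ENat.card (Fin n) := by simp
      _ ≤ (Set.range f).encard := hf.encard_range
      _ ≤ s.encard := Set.encard_le_encard (Set.range_subset_iff.2 hfs)

theorem definable_setOf_natCast_le_encard {F : M → Set M}
    (hF : A.Definable Lang {v : Fin 2 → M | v 1 ∈ F (v 0)}) (n : ℕ) :
    A.Definable₁ Lang {x | (n : ℕ∞) ≤ (F x).encard} := by
  have hinj : A.Definable Lang
      (⋂ p : {p : Fin n × Fin n // p.1 ≠ p.2},
        {w : Fin 1 ⊕ Fin n → M | w (Sum.inr p.1.1) = w (Sum.inr p.1.2)}ᶜ) :=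
    Set.definable_iInter_of_finite fun p => Set.Definable.compl
      ((Set.Definable.diagonal Lang A).preimage_comp ![Sum.inr p.1.1, Sum.inr p.1.2])
  have hmem : A.Definable Lang
      (⋂ i : Fin n, {w : Fin 1 ⊕ Fin n → M | w (Sum.inr i) ∈ F (w (Sum.inl 0))}) :=
    Set.definable_iInter_of_finite fun i => hF.preimage_comp ![Sum.inl 0, Sum.inr i]
  have hex := (hinj.inter hmem).exists_of_finite
  unfold Set.Definable₁
  convert hex using 1
  ext v
  refine natCast_le_encard_iff.trans (exists_congr fun f => ?_)
  simp only [Set.mem_inter_iff, Set.mem_iInter, Set.mem_compl_iff]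
  refine and_congr ⟨fun hf p hp => p.2 (hf hp), fun hf i j hij => ?_⟩ Iff.rfl
  by_contra hne
  exact hf ⟨(i, j), hne⟩ hij

theorem IsSaturated.nonempty_iInter_of_antitone (hM : IsSaturated Lang (M := M) ℵ₀)
    (hA : A.Finite) {S : ℕ → Set M} (hS : Antitone S) (hdef : ∀ n, A.Definable₁ Lang (S n))
    (hne : ∀ n, (S n).Nonempty) : (⋂ n, S n).Nonempty := by
  rw [← Set.sInter_range]
  refine hM A hA.lt_aleph0 (Set.range S) (Set.forall_mem_range.2 hdef) fun q hq hqfin => ?_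
  choose! index hindex using hq
  obtain ⟨b, hb⟩ := (hqfin.image index).bddAbove
  refine (hne b).mono (Set.subset_sInter fun s hs => ?_)
  rw [← hindex hs]
  exact hS (hb (Set.mem_image_of_mem index hs))

theorem IsSaturated.exists_forall_ncard_le (hM : IsSaturated Lang (M := M) ℵ₀) {D : Set M}
    {F : M → Set M} (hD : (Set.univ : Set M).Definable₁ Lang D)
    (hF : (Set.univ : Set M).Definable Lang {v : Fin 2 → M | v 1 ∈ F (v 0)})
    (hfin : ∀ x ∈ D, (F x).Finite) : ∃ n, ∀ x ∈ D, (F x).ncard ≤ n := by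
  obtain ⟨A, -, hA⟩ := Set.definable_iff_finitely_definable.1 hD
  obtain ⟨B, -, hB⟩ := Set.definable_iff_finitely_definable.1 hF
  by_contra! hunbounded
  obtain ⟨x, hx⟩ := hM.nonempty_iInter_of_antitone (A.finite_toSet.union B.finite_toSet)
    (S := fun n : ℕ => D ∩ {x | (n : ℕ∞) ≤ (F x).encard})
    (fun m n hmn => Set.inter_subset_inter_right D fun x (hx : (n : ℕ∞) ≤ (F x).encard) =>
      (Nat.cast_le.2 hmn).trans hx)
    (fun n => (hA.mono Set.subset_union_left).inter
      (definable_setOf_natCast_le_encard (hB.mono Set.subset_union_right) n))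
    fun n => by
      obtain ⟨x, hxD, hxn⟩ := hunbounded n
      refine ⟨x, hxD, ?_⟩
      rw [Set.mem_ofPred_eq, ← (hfin x hxD).cast_ncard_eq, Nat.cast_le]
      exact hxn.le
  rw [Set.mem_iInter] at hx
  exact (hfin x (hx 0).1).encard_lt_top.ne (ENat.eq_top_iff_forall_ge.2 fun n => (hx n).2)

end Saturation

section Definability

open FirstOrder Cardinal

variable {Lang : Language} [Lang.Structure G] {A : Set G}

theorem ExpandsGroup.definable_mul_eq (hG : ExpandsGroup Lang G) {α : Type*} (i j k : α) :
    A.Definable Lang {v : α → G | v i * v j = v k} :=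
  (hG.mono (Set.empty_subset A)).preimage_comp ![i, j, k]

-- The two witnesses form a vector because `Set.Definable.exists_of_finite` quantifies over vectors.
theorem mem_conjugates_iff_exists_mul_eq {x y : G} :
    y ∈ conjugates H x ↔ ∃ u : Fin 2 → G, u 0 ∈ H ∧ u 0 * x = u 1 ∧ y * u 0 = u 1 := by
  constructor
  · rintro ⟨h, hh, rfl⟩
    exact ⟨![h, h * x], hh, rfl, inv_mul_cancel_right (h * x) h⟩
  · rintro ⟨u, hu, hxu, hyu⟩
    exact ⟨u 0, hu, mul_inv_eq_of_eq_mul (hxu.trans hyu.symm)⟩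

theorem ExpandsGroup.definable_mem_conjugates (hG : ExpandsGroup Lang G)
    (hH : A.Definable₁ Lang (H : Set G)) :
    A.Definable Lang {v : Fin 2 → G | v 1 ∈ conjugates H (v 0)} := by
  have hex := ((definable_apply_mem hH (Sum.inr 0 : Fin 2 ⊕ Fin 2)).inter
    ((hG.definable_mul_eq (Sum.inr 0 : Fin 2 ⊕ Fin 2) (Sum.inl 0) (Sum.inr 1)).inter
    (hG.definable_mul_eq (Sum.inl 1 : Fin 2 ⊕ Fin 2) (Sum.inr 0) (Sum.inr 1)))).exists_of_finite
  simp only [mem_conjugates_iff_exists_mul_eq]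
  exact hex

theorem IsSaturated.exists_relIndex_centralizer_le (hs : IsSaturated Lang (M := G) ℵ₀)
    (hG : ExpandsGroup Lang G) (hH : IsDefinable Lang H) (hK : IsDefinable Lang K)
    (hKH : K ≤ almostCentralizer ⊤ H) :
    ∃ n, ∀ k ∈ K, (Subgroup.centralizer {k}).relIndex H ≤ n := by
  simp only [← ncard_conjugates]
  exact hs.exists_forall_ncard_le hK (hG.definable_mem_conjugates hH) fun k hk =>
    mem_almostCentralizer_top_iff_finite_conjugates.1 (hKH hk)

theorem isDefinable_top : IsDefinable Lang (⊤ : Subgroup G) := by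
  simp [IsDefinable, Set.Definable₁]

theorem isDefinable_bot : IsDefinable Lang (⊥ : Subgroup G) := by
  rw [IsDefinable, Subgroup.coe_bot]
  exact Set.Definable.singleton_of_mem Lang (Set.mem_univ 1)

end Definability

section Chains

variable {n d : ℕ}

theorem CentralizerChainsBounded.of_mulEquiv {Q : Type*} [Group Q]
    (hQ : CentralizerChainsBounded Q n d) (e : G ≃* Q) : CentralizerChainsBounded G n d := by
  intro m g hg
  have hcomap (T : Set ℕ) : (Subgroup.centralizer ((e ∘ g) '' T)).comap e.toMonoidHom =
      Subgroup.centralizer (g '' T) := by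
    ext x
    simp [Subgroup.mem_centralizer_iff, ← map_mul]
  refine hQ m (e ∘ g) fun i hi => ?_
  have hstep := hg i hi
  rwa [IndexAtLeast, ← hcomap, ← hcomap, Subgroup.relIndex_comap,
    Subgroup.map_comap_eq_self_of_surjective e.surjective] at hstep

theorem IsMcTilde.centralizerChainsBounded {Lang : FirstOrder.Language} [Lang.Structure G]
    (hG : IsMcTilde Lang G) : ∃ n d : ℕ, CentralizerChainsBounded G n d := by
  obtain ⟨n, d, hnd⟩ := hG ⊤ ⊥ isDefinable_top isDefinable_bot
    (by rw [Subgroup.normalizer_eq_top])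
  have hbot : (⊥ : Subgroup G).subgroupOf ⊤ = ⊥ := Subgroup.bot_subgroupOf _
  exact ⟨n, d, hnd.of_mulEquiv (Subgroup.topEquiv.symm.trans
    (QuotientGroup.quotientBot.symm.trans (QuotientGroup.quotientMulEquivOfEq hbot.symm)))⟩

theorem CentralizerChainsBounded.exists_finite_subset (hG : CentralizerChainsBounded G n d)
    (S : Set G) : ∃ F ⊆ S, F.Finite ∧ ∀ s ∈ S,
      ¬ IndexAtLeast d (Subgroup.centralizer (insert s F)) (Subgroup.centralizer F) := by
  by_contra! hextend
  obtain ⟨s₀, hs₀, -⟩ := hextend ∅ (Set.empty_subset S) Set.finite_empty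
  obtain ⟨g, hg⟩ := Set.seq_of_forall_finite_exists (P := fun s t => s ∈ S ∧ (t ⊆ S →
      IndexAtLeast d (Subgroup.centralizer (insert s t)) (Subgroup.centralizer t)))
    fun t ht => by
      by_cases htS : t ⊆ S
      · obtain ⟨s, hs, hst⟩ := hextend t htS ht
        exact ⟨s, hs, fun _ => hst⟩
      · exact ⟨s₀, hs₀, fun h => absurd h htS⟩
  have hlong : n + 1 ≤ n := hG (n + 1) g fun i _ => by
    have hstep := (hg (i + 1)).2 (Set.image_subset_iff.2 fun j _ => (hg j).1)
    rw [← Set.image_insert_eq, Set.Iio_insert] at hstep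
    rwa [← Order.Iio_succ i]
  exact absurd hlong (Nat.not_succ_le_self n)

theorem CentralizerChainsBounded.exists_relIndex_centralizer_le
    (hG : CentralizerChainsBounded G n d) (hKH : K ≤ almostCentralizer ⊤ H) :
    ∃ N, ∀ k ∈ K, (Subgroup.centralizer {k}).relIndex H ≤ N := by
  obtain ⟨F, hFK, hF, hd⟩ := hG.exists_finite_subset (K : Set G)
  let C : Subgroup G := Subgroup.centralizer F
  refine ⟨d * C.relIndex H, fun k hk => ?_⟩
  let Ck : Subgroup G := Subgroup.centralizer (insert k F)
  have hCkC : Ck ≤ C := Subgroup.centralizer_le (Set.subset_insert k F)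
  have hCk : Ck ≤ Subgroup.centralizer {k} :=
    Subgroup.centralizer_le (Set.singleton_subset_iff.2 (Set.mem_insert k F))
  have hne : Ck.relIndex H ≠ 0 := relIndex_centralizer_ne_zero_of_finite (hF.insert k)
    (Set.insert_subset (hKH hk) (hFK.trans hKH))
  obtain ⟨hrel_ne, hrel_lt⟩ := not_or.1 (hd k hk)
  calc (Subgroup.centralizer {k}).relIndex H ≤ Ck.relIndex H :=
        Subgroup.relIndex_le_of_le_left hCk hne
    _ = Ck.relIndex (C ⊓ H) * C.relIndex H := by
        rw [Subgroup.relIndex_inf_mul_relIndex, inf_of_le_left hCkC]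
    _ ≤ Ck.relIndex C * C.relIndex H :=
        Nat.mul_le_mul_right _ (Subgroup.relIndex_le_of_le_right inf_le_left hrel_ne)
    _ ≤ d * C.relIndex H := Nat.mul_le_mul_right _ (not_le.1 hrel_lt).le

end Chains

end AlmostCentralizer

theorem mainTheorem10_general (Lang : FirstOrder.Language) (L : Type*) [Group L] [Lang.Structure L]
    (hL : AlmostCentralizer.ExpandsGroup Lang L) :
    (AlmostCentralizer.IsSaturated Lang (M := L) Cardinal.aleph0 →
      ∀ H K : Subgroup L,
        AlmostCentralizer.IsDefinable Lang H → AlmostCentralizer.IsDefinable Lang K →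
        K ≤ Subgroup.normalizer H →
        K ≤ AlmostCentralizer.almostCentralizer ⊤ H →
        H ≤ AlmostCentralizer.almostCentralizer ⊤ K →
        Finite (⁅K, H⁆ : Subgroup L)) ∧
    (∀ n d : ℕ, AlmostCentralizer.CentralizerChainsBounded L n d →
      ∀ H K : Subgroup L,
        K ≤ Subgroup.normalizer H →
        K ≤ AlmostCentralizer.almostCentralizer ⊤ H →
        H ≤ AlmostCentralizer.almostCentralizer ⊤ K →
        Finite (⁅K, H⁆ : Subgroup L)) := by
  refine ⟨fun hs H K hH hK hKN hKH hHK => ?_, fun n d hnd H K hKN hKH hHK => ?_⟩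
  · obtain ⟨N, hN⟩ := hs.exists_relIndex_centralizer_le hL hH hK hKH
    exact AlmostCentralizer.finite_commutator_of_relIndex_le hKN hKH hHK hN
  · obtain ⟨N, hN⟩ := hnd.exists_relIndex_centralizer_le hKH
    exact AlmostCentralizer.finite_commutator_of_relIndex_le hKN hKH hHK hN

theorem mainTheorem10 (Lang : FirstOrder.Language) (L : Type*) [Group L] [Lang.Structure L]
    (hL : AlmostCentralizer.ExpandsGroup Lang L) :
    (AlmostCentralizer.IsSaturated Lang (M := L) Cardinal.aleph0 →
      ∀ H K : Subgroup L,
        AlmostCentralizer.IsDefinable Lang H → AlmostCentralizer.IsDefinable Lang K →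
        K ≤ Subgroup.normalizer H →
        K ≤ AlmostCentralizer.almostCentralizer ⊤ H →
        H ≤ AlmostCentralizer.almostCentralizer ⊤ K →
        Finite (⁅K, H⁆ : Subgroup L)) ∧
    (AlmostCentralizer.IsMcTilde Lang L →
      Finite (⁅AlmostCentralizer.almostCenter L,
        AlmostCentralizer.almostCentralizer ⊤ (AlmostCentralizer.almostCenter L)⁆ :
          Subgroup L)) := by
  refine ⟨(mainTheorem10_general Lang L hL).1, fun hMc => ?_⟩
  obtain ⟨n, d, hnd⟩ := hMc.centralizerChainsBounded
  have hcenter (H : Subgroup L) : AlmostCentralizer.almostCenter L ≤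
      AlmostCentralizer.almostCentralizer ⊤ H :=
    AlmostCentralizer.almostCentralizer_anti_right ⊤ le_top
  exact (mainTheorem10_general Lang L hL).2 n d hnd _ _ ((hcenter _).trans Subgroup.le_normalizer)
    (hcenter _) le_rfl
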